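/- Let $A$ be a finite alphabet and let $\sigma\colon A^*\to A^*$ be an endomorphism of the free monoid $A^*$; letters may be erased, that is, $\sigma(a)=\varepsilon$ is allowed. Let $\mathcal L(\sigma)$ be the set of all factors (contiguous subwords) of the words $\sigma^n(a)$, $n\ge 0$, $a\in A$, and let $\mathsf X(\sigma)\subseteq A^{\mathbb Z}$ be the shift space of all two-sided infinite sequences all of whose finite factors belong to $\mathcal L(\sigma)$. Here $A^{\mathbb Z}$ carries the product of the discrete topologies, and a shift space is a closed shift-invariant subset; it is minimal if it is nonempty and contains no nonempty shift space properly. If $\mathsf X(\sigma)$ is minimal, then there are a finite alphabet $B$ and a primitive endomorphism $\tau\colon B^*\to B^*$ (that is, there is an $n\ge 1$ such that for all $a,b\in B$ the letter $b$ occurs in $\tau^n(a)$) such that $\mathsf X(\sigma)$ is conjugate to $\mathsf X(\tau)$, that is, there is a homeomorphism $\varphi\colon \mathsf X(\sigma)\to\mathsf X(\tau)$ that commutes with the shift maps. -/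

import Mathlib

namespace SubstitutionShift

open SymbolicDynamics.FullShift

/-- The word `x_i x_{i+1} ⋯ x_{i+n-1}` occurring in the two-sided sequence `x`. -/
def factor {A : Type*} (x : ℤ → A) (i : ℤ) (n : ℕ) : List A :=
  List.ofFn fun k : Fin n => x (i + (k : ℤ))

/-- The language of an endomorphism `σ` of the free monoid `A*` (letters may be erased):
all factors (contiguous subwords) of the words `σⁿ(a)`, for `n ≥ 0` and `a` a letter. -/
def language {A : Type*} (σ : FreeMonoid A →* FreeMonoid A) : Set (List A) :=
  {w | ∃ (n : ℕ) (a : A), w <:+: FreeMonoid.toList (σ^[n] (FreeMonoid.of a))}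

/-- The substitution shift `X(σ)`: the two-sided sequences over `A` all of whose factors belong to
the language of `σ`. -/
def shiftSpace {A : Type*} [TopologicalSpace A] [DiscreteTopology A]
    (σ : FreeMonoid A →* FreeMonoid A) : Subshift A ℤ where
  carrier := {x | ∀ (i : ℤ) (n : ℕ), factor x i n ∈ language σ}
  isClosed := by
    have hc : ∀ (i : ℤ) (n : ℕ),
        Continuous fun x : ℤ → A => fun k : Fin n => x (i + (k : ℤ)) :=
      fun i n => continuous_pi fun k => continuous_apply _
    simp only [Set.ofPred_forall]
    refine isClosed_iInter fun i => isClosed_iInter fun n => ?_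
    exact (isClosed_discrete {v : Fin n → A | List.ofFn v ∈ language σ}).preimage (hc i n)
  mapsTo := by
    intro g x hx i n
    have h : factor (shift g x) i n = factor x (g + i) n := by
      simp [factor, add_assoc]
    rw [h]
    exact hx (g + i) n

/-- A shift space is minimal if it is nonempty and contains no nonempty shift space properly. -/
def IsMinimal {A : Type*} [TopologicalSpace A] (X : Subshift A ℤ) : Prop :=
  X.carrier.Nonempty ∧
    ∀ Y : Subshift A ℤ, Y.carrier.Nonempty → Y.carrier ⊆ X.carrier → Y.carrier = X.carrier

/-- Two shift spaces, possibly on different alphabets, are conjugate if there is a homeomorphism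
of the one onto the other that commutes with the shift maps. -/
def Conjugate {A B : Type*} [TopologicalSpace A] [TopologicalSpace B]
    (X : Subshift A ℤ) (Y : Subshift B ℤ) : Prop :=
  ∃ φ : X.carrier ≃ₜ Y.carrier, ∀ x : X.carrier,
    (φ ⟨shift 1 x.1, X.mapsTo 1 x.2⟩).1 = shift 1 (φ x).1

/-- An endomorphism `σ` of `A*` is primitive if for some `n ≥ 1` every letter occurs in `σⁿ(a)`
for every letter `a`. -/
def IsPrimitive {A : Type*} (σ : FreeMonoid A →* FreeMonoid A) : Prop :=
  ∃ n : ℕ, 1 ≤ n ∧ ∀ a b : A, b ∈ FreeMonoid.toList (σ^[n] (FreeMonoid.of a))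

end SubstitutionShift

/-! Two tasks arise: erasing and non-growing letters must be tamed, and a primitive substitution
must be found for the whole shift rather than for an induced system.

For the first, `IsMinimal.exists_isMorph` finds a morphism `f` that preserves the language of X =
X(σ) and has a letter `a` of X with unbounded iterated images. If a growing letter occurs in X, it
occurs with bounded gaps, so σ maps long words of X to long words, and `f` = σ works. Otherwise a
growing letter b that recurs satisfies σ^k(b) = u b v with u, v non-growing. The iterates of u and v
become stationary, X contains all powers of some word t, and w ↦ t^(2|w|) works.

For the second, minimality leaves finitely many return words θ(i) to `a`. A power T of `f` with T(a)
= p a s satisfies p · spell(D i) = T(θ i) · p: after conjugation by p it sends return words to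
concatenations of return words (`IsMinimal.exists_derived`). For a high power each D i contains
every return word and has at least |θ(i)| entries. This substitution D describes only the system
induced on the occurrences of `a`; X is a tower over it, with letters the positions (i, k) in θ(i).
Cutting D i into |θ(i)| nonempty blocks, one per position, gives a primitive substitution on the
tower alphabet. Recording the position of each coordinate in its return word is a sliding block code
from X onto its shift, inverted by a letter-to-letter map (`conjugate_towerSubst`). -/

namespace SubstitutionShift

open SymbolicDynamics.FullShift

/-! ### Factors, languages and compactness -/

section Factors

variable {A : Type*}

@[simp] theorem length_factor (x : ℤ → A) (i : ℤ) (n : ℕ) : (factor x i n).length = n := by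
  simp [factor]

theorem factor_add (x : ℤ → A) (i : ℤ) (m n : ℕ) :
    factor x i (m + n) = factor x i m ++ factor x (i + m) n := by
  simp [factor, List.ofFn_add, add_assoc]

theorem factor_one (x : ℤ → A) (i : ℤ) : factor x i 1 = [x i] := by
  simp [factor]

theorem factor_succ (x : ℤ → A) (i : ℤ) (n : ℕ) :
    factor x i (n + 1) = x i :: factor x (i + 1) n := by
  rw [add_comm n 1, factor_add, factor_one]; simp

theorem factor_eq_factor_iff {x y : ℤ → A} {i j : ℤ} {n : ℕ} :
    factor x i n = factor y j n ↔ ∀ k : ℕ, k < n → x (i + k) = y (j + k) := by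
  simp only [factor, List.ofFn_inj, funext_iff]
  exact ⟨fun h k hk => h ⟨k, hk⟩, fun h k => h k k.2⟩

theorem factor_map {B : Type*} (g : A → B) (x : ℤ → A) (i : ℤ) (n : ℕ) :
    factor (fun j => g (x j)) i n = (factor x i n).map g := by
  simp [factor, List.map_ofFn, Function.comp_def]

theorem mem_factor {x : ℤ → A} {i : ℤ} {n : ℕ} {c : A} :
    c ∈ factor x i n ↔ ∃ k : ℕ, k < n ∧ x (i + k) = c := by
  simp only [factor, List.mem_ofFn]
  exact ⟨fun ⟨k, hk⟩ => ⟨k, k.2, hk⟩, fun ⟨k, hk, h⟩ => ⟨⟨k, hk⟩, h⟩⟩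

/-- If a factor is a concatenation, both parts are factors. -/
theorem factor_eq_append {x : ℤ → A} {i : ℤ} {n : ℕ} {u v : List A} (h : factor x i n = u ++ v) :
    factor x i u.length = u ∧ factor x (i + u.length) v.length = v := by
  have hn : n = u.length + v.length := by
    have := congrArg List.length h
    simpa using this
  subst hn
  rw [factor_add] at h
  exact List.append_inj h (by simp)

theorem exists_factor_of_infix {x : ℤ → A} {i : ℤ} {n : ℕ} {w : List A}
    (h : w <:+: factor x i n) : ∃ k : ℕ, k + w.length ≤ n ∧ factor x (i + k) w.length = w := by
  obtain ⟨u, v, h⟩ := h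
  refine ⟨u.length, ?_, ?_⟩
  · have := congrArg List.length h
    simp at this
    omega
  · exact (factor_eq_append (factor_eq_append h.symm).1).2

theorem factor_infix_factor (x : ℤ → A) (i : ℤ) {k n m : ℕ} (h : k + m ≤ n) :
    factor x (i + k) m <:+: factor x i n := by
  obtain ⟨l, rfl⟩ := Nat.exists_eq_add_of_le h
  exact ⟨factor x i k, factor x (i + (k + m : ℕ)) l, by rw [factor_add, factor_add]⟩

theorem factor_infix_factor' (x : ℤ → A) {i j : ℤ} {n m : ℕ} (h : i ≤ j) (h' : j + m ≤ i + n) :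
    factor x j m <:+: factor x i n := by
  obtain ⟨k, rfl⟩ := Int.le.dest h
  exact factor_infix_factor x i (by omega)

theorem factor_shift (x : ℤ → A) (g i : ℤ) (n : ℕ) :
    factor (shift g x) i n = factor x (g + i) n := by
  simp [factor, add_assoc]

theorem language_of_infix {σ : FreeMonoid A →* FreeMonoid A} {u w : List A} (h : u <:+: w)
    (hw : w ∈ language σ) : u ∈ language σ := by
  obtain ⟨n, a, hw⟩ := hw
  exact ⟨n, a, h.trans hw⟩

variable [TopologicalSpace A]

/-- The words occurring in the points of a shift space. -/
def lang (X : Subshift A ℤ) : Set (List A) :=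
  {w | ∃ x ∈ X.carrier, ∃ i, factor x i w.length = w}

theorem factor_mem_lang {X : Subshift A ℤ} {x : ℤ → A} (hx : x ∈ X.carrier) (i : ℤ) (n : ℕ) :
    factor x i n ∈ lang X :=
  ⟨x, hx, i, by simp⟩

theorem lang_of_infix {X : Subshift A ℤ} {u w : List A} (h : u <:+: w) (hw : w ∈ lang X) :
    u ∈ lang X := by
  obtain ⟨x, hx, i, hi⟩ := hw
  rw [← hi] at h
  obtain ⟨k, -, hk⟩ := exists_factor_of_infix h
  exact ⟨x, hx, _, hk⟩

theorem exists_mem_append_of_mem_lang {X : Subshift A ℤ} {w : List A} (hw : w ∈ lang X) (n : ℕ) :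
    ∃ u v : List A, u.length = n ∧ v.length = n ∧ u ++ w ++ v ∈ lang X := by
  obtain ⟨x, hx, i, hi⟩ := hw
  refine ⟨factor x (i - n) n, factor x (i + w.length) n, by simp, by simp, ?_⟩
  have : factor x (i - n) (n + w.length + n) =
      factor x (i - n) n ++ w ++ factor x (i + w.length) n := by
    rw [factor_add, factor_add]
    congr 2
    · rw [sub_add_cancel, hi]
    · push_cast; ring
  rw [← this]
  exact factor_mem_lang hx _ _

variable [DiscreteTopology A]

theorem isClopen_factor_mem (S : Set (List A)) (i : ℤ) (n : ℕ) :
    IsClopen {x : ℤ → A | factor x i n ∈ S} := by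
  have hc : Continuous fun x : ℤ → A => fun k : Fin n => x (i + (k : ℤ)) :=
    continuous_pi fun k => continuous_apply _
  exact (isClopen_discrete {v : Fin n → A | List.ofFn v ∈ S}).preimage hc

theorem language_of_lang {σ : FreeMonoid A →* FreeMonoid A} {w : List A}
    (hw : w ∈ lang (shiftSpace σ)) : w ∈ language σ := by
  obtain ⟨x, hx, i, hi⟩ := hw
  rw [← hi]
  exact hx _ _

variable [Finite A]

/-- In a minimal shift space, every word of the language occurs in all long enough words. -/
theorem IsMinimal.exists_infix_of_le_length {X : Subshift A ℤ} (hX : IsMinimal X) {w : List A}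
    (hw : w ∈ lang X) :
    ∃ N : ℕ, ∀ v ∈ lang X, N ≤ v.length → w <:+: v := by
  have key : ∀ y ∈ X.carrier, ∃ i, factor y i w.length = w := by
    by_contra! hcon
    obtain ⟨y, hy, hyw⟩ := hcon
    -- The points of `X` that avoid `w` form a subshift, which minimality forces to be all of `X`.
    let Y : Subshift A ℤ :=
      { carrier := X.carrier ∩ ⋂ i : ℤ, {x | factor x i w.length ∈ ({w}ᶜ : Set (List A))}
        isClosed := X.isClosed.inter
          (isClosed_iInter fun i => (isClopen_factor_mem _ i _).isClosed)
        mapsTo := by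
          rintro g x ⟨hx, hx'⟩
          refine ⟨X.mapsTo g hx, ?_⟩
          simp only [Set.mem_iInter] at hx' ⊢
          intro i
          simpa only [Set.mem_ofPred, factor_shift] using hx' (g + i) }
    have hY := hX.2 Y ⟨y, hy, by simpa using hyw⟩ Set.inter_subset_left
    obtain ⟨x, hx, i, hi⟩ := hw
    rw [← hY] at hx
    have := Set.mem_iInter.1 hx.2 i
    exact this hi
  have hc : IsCompact X.carrier := X.isClosed.isCompact
  obtain ⟨t, ht⟩ := hc.elim_finite_subcover
    (fun i : ℤ => {x : ℤ → A | factor x i w.length ∈ ({w} : Set (List A))})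
    (fun i => (isClopen_factor_mem _ i _).isOpen) (fun y hy => by
      obtain ⟨i, hi⟩ := key y hy
      exact Set.mem_iUnion.2 ⟨i, hi⟩)
  obtain ⟨M, hM⟩ : ∃ M : ℕ, ∀ i ∈ t, i.natAbs ≤ M :=
    ⟨t.sup Int.natAbs, fun i hi => Finset.le_sup (f := Int.natAbs) hi⟩
  -- The finite subcover bounds the position of `w` by `M` in absolute value. Centring at `i + M`
  -- puts the occurrence into the window of this length that starts at `i`.
  refine ⟨M + M + w.length, ?_⟩
  rintro v ⟨x, hx, i, hi⟩ hv
  have := ht (X.mapsTo (i + M) hx)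
  simp only [Set.mem_iUnion] at this
  obtain ⟨j, hj, hj'⟩ := this
  replace hj' : factor (shift (i + M) x) j w.length = w := hj'
  rw [factor_shift] at hj'
  have hjM := hM j hj
  rw [← hi, ← hj']
  exact factor_infix_factor' x (by omega) (by omega)

/-- A word with arbitrarily long extensions to both sides occurs in the shift space. -/
theorem mem_lang_of_forall_extension {σ : FreeMonoid A →* FreeMonoid A} {w : List A}
    (h : ∀ n : ℕ, ∃ u v : List A, n ≤ u.length ∧ n ≤ v.length ∧ u ++ w ++ v ∈ language σ) :
    w ∈ lang (shiftSpace σ) := by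
  have hA : Nonempty A := by
    obtain ⟨u, v, hu, -, -⟩ := h 1
    exact ⟨u.head (List.length_pos_iff.1 hu)⟩
  obtain ⟨a₀⟩ := hA
  -- A decreasing sequence of compact sets; a common point has `w` at 0 and all its central windows
  -- in the language.
  let K : ℕ → Set (ℤ → A) := fun n =>
    {x | factor x 0 w.length ∈ ({w} : Set (List A))} ∩
      {x | factor x (-n) (n + (w.length + n)) ∈ language σ}
  have hK : ∀ n, IsClosed (K n) := fun n =>
    (isClopen_factor_mem _ _ _).isClosed.inter (isClopen_factor_mem _ _ _).isClosed
  have hne : (⋂ n, K n).Nonempty := by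
    refine IsCompact.nonempty_iInter_of_sequence_nonempty_isCompact_isClosed K ?_ ?_
      (hK 0).isCompact hK
    · rintro n x ⟨hx, hx'⟩
      exact ⟨hx, language_of_infix (factor_infix_factor' x (by omega) (by push_cast; omega)) hx'⟩
    · intro n
      obtain ⟨u, v, hu, hv, huv⟩ := h n
      let x : ℤ → A := fun i => (u ++ w ++ v).getD (i + u.length).toNat a₀
      have hx : factor x (-u.length) (u ++ w ++ v).length = u ++ w ++ v := by
        apply List.ext_getElem (by simp)
        intro k h1 h2
        simp only [factor, List.getElem_ofFn, x]
        rw [List.getD_eq_getElem _ _ (by simpa using h2)]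
        congr 1
        omega
      refine ⟨x, ?_, ?_⟩
      · have := (factor_eq_append (factor_eq_append hx).1).2
        simpa using this
      · rw [← hx] at huv
        refine language_of_infix (factor_infix_factor' x (by omega) ?_) huv
        simp only [List.length_append]; push_cast; omega
  obtain ⟨x, hx⟩ := hne
  simp only [Set.mem_iInter] at hx
  refine ⟨x, fun i n => ?_, 0, (hx 0).1⟩
  refine language_of_infix (factor_infix_factor' x (i := -(i.natAbs + n : ℕ)) ?_ ?_)
    (hx (i.natAbs + n)).2
  · omega
  · omega

end Factors

/-! ### Morphisms of words -/

section Morphisms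

variable {A B : Type*}

/-- A map on words that respects concatenation. -/
def IsMorph (f : List A → List B) : Prop := ∀ u v, f (u ++ v) = f u ++ f v

theorem IsMorph.nil {f : List A → List B} (hf : IsMorph f) : f [] = [] := by
  have := congrArg List.length (hf [] [])
  simpa using this

theorem IsMorph.cons {f : List A → List B} (hf : IsMorph f) (c : A) (w : List A) :
    f (c :: w) = f [c] ++ f w := hf [c] w

theorem IsMorph.infix {f : List A → List B} (hf : IsMorph f) {u v : List A} (h : u <:+: v) :
    f u <:+: f v := by
  obtain ⟨s, t, rfl⟩ := h
  exact ⟨f s, f t, by rw [hf, hf]⟩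

theorem IsMorph.infix_of_mem {f : List A → List B} (hf : IsMorph f) {c : A} {v : List A}
    (h : c ∈ v) : f [c] <:+: f v := by
  obtain ⟨s, t, rfl⟩ := List.append_of_mem h
  exact hf.infix ⟨s, t, by simp⟩

theorem IsMorph.iterate {f : List A → List A} (hf : IsMorph f) (n : ℕ) : IsMorph f^[n] := by
  intro u v
  induction n generalizing u v with
  | zero => rfl
  | succ n ih => simp only [Function.iterate_succ_apply, hf u v, ih]

theorem IsMorph.congr {f g : List A → List B} (hf : IsMorph f) (hg : IsMorph g) {w : List A}
    (h : ∀ c ∈ w, f [c] = g [c]) : f w = g w := by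
  induction w with
  | nil => rw [hf.nil, hg.nil]
  | cons c w ih =>
    rw [hf.cons, hg.cons, h c (by simp), ih fun c' hc' => h c' (by simp [hc'])]

theorem IsMorph.count_le_length [DecidableEq A] {f : List A → List B} (hf : IsMorph f) {d : A}
    (hd : f [d] ≠ []) (w : List A) : w.count d ≤ (f w).length := by
  induction w with
  | nil => simp
  | cons c w ih =>
    rw [hf.cons, List.length_append, List.count_cons]
    have : 0 < (f [d]).length := List.length_pos_iff.2 hd
    split_ifs with h
    · have : c = d := by simpa using h
      subst this; omega
    · omega

/-- The map on words given by a homomorphism of free monoids. -/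
def wordMap (σ : FreeMonoid A →* FreeMonoid B) (w : List A) : List B :=
  FreeMonoid.toList (σ (FreeMonoid.ofList w))

theorem isMorph_wordMap (σ : FreeMonoid A →* FreeMonoid B) : IsMorph (wordMap σ) := by
  intro u v
  simp [wordMap, FreeMonoid.ofList_append]

theorem wordMap_iterate (σ : FreeMonoid A →* FreeMonoid A) (n : ℕ) (w : List A) :
    (wordMap σ)^[n] w = FreeMonoid.toList (σ^[n] (FreeMonoid.ofList w)) := by
  induction n generalizing w with
  | zero => rfl
  | succ n ih => rw [Function.iterate_succ_apply, ih, Function.iterate_succ_apply]; rfl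

theorem mem_language {σ : FreeMonoid A →* FreeMonoid A} {w : List A} :
    w ∈ language σ ↔ ∃ n a, w <:+: (wordMap σ)^[n] [a] := by
  simp only [wordMap_iterate]; rfl

theorem wordMap_mem_language {σ : FreeMonoid A →* FreeMonoid A} {w : List A}
    (hw : w ∈ language σ) : wordMap σ w ∈ language σ := by
  obtain ⟨n, a, h⟩ := mem_language.1 hw
  refine mem_language.2 ⟨n + 1, a, ?_⟩
  rw [Function.iterate_succ_apply']
  exact (isMorph_wordMap σ).infix h

end Morphisms

/-! ### Growing and non-growing letters -/

section Growing

variable {A : Type*} {f : List A → List A}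

/-- A letter is growing if its iterated images are pairwise different; over a finite alphabet this
means that their lengths are unbounded. -/
def Growing (f : List A → List A) (c : A) : Prop := Function.Injective fun n => f^[n] [c]

/-- A word is non-growing if none of its letters is growing. -/
def NonGrowing (f : List A → List A) (w : List A) : Prop := ∀ c ∈ w, ¬ Growing f c

theorem iterate_mul_eq_of_not_injective {w : List A} (h : ¬ Function.Injective fun n => f^[n] w) :
    ∃ M, 0 < M ∧ ∀ j, 0 < j → f^[M * j] w = f^[M] w := by
  obtain ⟨i, j, hij, hne⟩ : ∃ i j, f^[i] w = f^[j] w ∧ i < j := by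
    simp only [Function.Injective, not_forall] at h
    obtain ⟨i, j, h, hne⟩ := h
    rcases lt_or_gt_of_ne hne with hlt | hlt
    · exact ⟨i, j, h, hlt⟩
    · exact ⟨j, i, h.symm, hlt⟩
  obtain ⟨q, rfl⟩ := Nat.exists_eq_add_of_lt hne
  have step : ∀ n, i ≤ n → f^[n + (q + 1)] w = f^[n] w := by
    intro n hn
    obtain ⟨m, rfl⟩ := Nat.exists_eq_add_of_le hn
    rw [show i + m + (q + 1) = m + (i + q + 1) by omega, Function.iterate_add_apply, ← hij,
      ← Function.iterate_add_apply, add_comm]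
  have steps : ∀ m n, i ≤ n → f^[n + (q + 1) * m] w = f^[n] w := by
    intro m
    induction m with
    | zero => simp
    | succ m ih =>
      intro n hn
      rw [show n + (q + 1) * (m + 1) = n + (q + 1) * m + (q + 1) by ring, step _ (by omega),
        ih n hn]
  -- A multiple of the period `q + 1` that is not below the preperiod `i`.
  refine ⟨(q + 1) * (i + 1), by positivity, fun j hj => ?_⟩
  obtain ⟨j, rfl⟩ := Nat.exists_eq_add_of_lt hj
  rw [show (q + 1) * (i + 1) * (0 + j + 1) = (q + 1) * (i + 1) + (q + 1) * ((i + 1) * j) by ring]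
  exact steps _ _ (by nlinarith)

/-- Only finitely many words are shorter than `N`, and an injective orbit meets each at most once.
-/
theorem Growing.exists_le_length [Finite A] {c : A} (h : Growing f c) (N : ℕ) :
    ∃ n₀, ∀ n, n₀ ≤ n → N ≤ (f^[n] [c]).length := by
  have hfin : ((fun n => f^[n] [c]) ⁻¹' {l : List A | l.length < N}).Finite :=
    (List.finite_length_lt A N).preimage h.injOn
  obtain ⟨m, hm⟩ := hfin.bddAbove
  refine ⟨m + 1, fun n hn => ?_⟩
  by_contra! hlt
  have := hm hlt
  omega

theorem Growing.exists_le_length_of_mem [Finite A] (hf : IsMorph f) {c : A} {w : List A}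
    (h : Growing f c) (hc : c ∈ w) (N : ℕ) : ∃ n₀, ∀ n, n₀ ≤ n → N ≤ (f^[n] w).length := by
  obtain ⟨n₀, hn₀⟩ := h.exists_le_length N
  exact ⟨n₀, fun n hn => (hn₀ n hn).trans ((hf.iterate n).infix_of_mem hc).length_le⟩

variable [Finite A]

/-- There is one exponent that makes the iterates of all non-growing words stationary. -/
theorem exists_iterate_mul_eq (hf : IsMorph f) :
    ∃ M, 0 < M ∧ ∀ w, NonGrowing f w → ∀ j, 0 < j → f^[M * j] w = f^[M] w := by
  have h : ∀ c : A, ∃ M, 0 < M ∧ (¬ Growing f c → ∀ j, 0 < j → f^[M * j] [c] = f^[M] [c]) := by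
    intro c
    by_cases hc : Growing f c
    · exact ⟨1, one_pos, fun h => absurd hc h⟩
    · obtain ⟨M, hM, h⟩ := iterate_mul_eq_of_not_injective hc
      exact ⟨M, hM, fun _ => h⟩
  choose M hM h using h
  have := Fintype.ofFinite A
  refine ⟨∏ c, M c, Finset.prod_pos fun c _ => hM c, fun w hw j hj => ?_⟩
  refine (hf.iterate _).congr (hf.iterate _) fun c hc => ?_
  obtain ⟨k, hk⟩ := Finset.dvd_prod_of_mem M (Finset.mem_univ c)
  have hk0 : 0 < k := by
    rcases Nat.eq_zero_or_pos k with rfl | hk'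
    · have := Finset.prod_pos fun c (_ : c ∈ Finset.univ) => hM c
      simp [hk] at this
    · exact hk'
  rw [hk, mul_assoc, h c (hw c hc) _ (by positivity), h c (hw c hc) _ hk0]

theorem Growing.not_nonGrowing (hf : IsMorph f) {c : A} (h : Growing f c) (n : ℕ) :
    ¬ NonGrowing f (f^[n] [c]) := by
  intro hn
  obtain ⟨M, hM, hw⟩ := exists_iterate_mul_eq hf
  have := hw _ hn 2 two_pos
  rw [← Function.iterate_add_apply, ← Function.iterate_add_apply] at this
  have := h this
  omega

/-- Along multiples of `M` the iterates of `w` are constant, whereas a growing letter in `f^[n] w`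
would make their lengths unbounded. -/
theorem NonGrowing.iterate (hf : IsMorph f) {w : List A} (hw : NonGrowing f w) (n : ℕ) :
    NonGrowing f (f^[n] w) := by
  intro d hd hgr
  obtain ⟨M, hM, h⟩ := exists_iterate_mul_eq hf
  obtain ⟨m, hm⟩ := hgr.exists_le_length_of_mem hf hd ((f^[M] w).length + 1)
  have h1 := hm (M * (m + n + 1) - n) (by
    have : (m + n + 1) ≤ M * (m + n + 1) := Nat.le_mul_of_pos_left _ hM
    omega)
  rw [← Function.iterate_add_apply, Nat.sub_add_cancel (by
    have : (m + n + 1) ≤ M * (m + n + 1) := Nat.le_mul_of_pos_left _ hM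
    omega), h w hw _ (by omega)] at h1
  omega

theorem Growing.not_nonGrowing_of_mem (hf : IsMorph f) {c : A} {w : List A} (h : Growing f c)
    (hc : c ∈ w) (n : ℕ) : ∃ d ∈ f^[n] w, Growing f d := by
  have := h.not_nonGrowing hf n
  simp only [NonGrowing, not_forall, not_not] at this
  obtain ⟨d, hd, hgr⟩ := this
  exact ⟨d, ((hf.iterate n).infix_of_mem hc).subset hd, hgr⟩

/-- If there is a growing letter, then some growing letter occurs in an iterated image of
itself. -/
theorem Growing.exists_recurrent (hf : IsMorph f) {c : A} (h : Growing f c) :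
    ∃ b k, Growing f b ∧ 0 < k ∧ b ∈ f^[k] [b] := by
  -- Every growing letter has a growing letter in its image; a chain of such successors must repeat.
  have hsucc : ∀ c : {c // Growing f c}, ∃ d : {c // Growing f c}, d.1 ∈ f [c.1] := by
    rintro ⟨c, hc⟩
    obtain ⟨d, hd, hgr⟩ := hc.not_nonGrowing_of_mem hf (List.mem_singleton_self c) 1
    exact ⟨⟨d, hgr⟩, hd⟩
  choose g hg using hsucc
  have hiter : ∀ n c, (g^[n] c).1 ∈ f^[n] [c.1] := by
    intro n
    induction n with
    | zero => simp
    | succ n ih =>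
      intro c
      rw [Function.iterate_succ_apply, Function.iterate_succ_apply]
      exact ((hf.iterate n).infix_of_mem (hg c)).subset (ih (g c))
  obtain ⟨i, j, hne, hij⟩ := Finite.exists_ne_map_eq_of_infinite fun n => g^[n] ⟨c, h⟩
  wlog hlt : i < j generalizing i j
  · exact this j i hne.symm hij.symm (by omega)
  obtain ⟨k, rfl⟩ := Nat.exists_eq_add_of_lt hlt
  refine ⟨(g^[i] ⟨c, h⟩).1, k + 1, (g^[i] ⟨c, h⟩).2, by omega, ?_⟩
  have := hiter (k + 1) (g^[i] ⟨c, h⟩)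
  rw [← Function.iterate_add_apply, show k + 1 + i = i + k + 1 by omega] at this
  change g^[i] ⟨c, h⟩ = g^[i + k + 1] ⟨c, h⟩ at hij
  rwa [← hij] at this

/-- If a growing letter `b` occurs in an image of itself, with only non-growing letters besides
it, then some nonempty word has all its powers in the iterated images of `b`. -/
theorem Growing.exists_powers (hf : IsMorph f) {b : A} (hb : Growing f b) {k : ℕ} (hk : 0 < k)
    {u v : List A} (huv : f^[k] [b] = u ++ [b] ++ v) (hu : NonGrowing f u)
    (hv : NonGrowing f v) :
    ∃ t : List A, t ≠ [] ∧ ∀ m, ∃ n, (List.replicate m t).flatten <:+: f^[n] [b] := by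
  obtain ⟨M, hM, hw⟩ := exists_iterate_mul_eq hf
  have hiter : ∀ m, ∃ u v, NonGrowing f u ∧ NonGrowing f v ∧
      f^[k * (m + 1)] [b] = u ++ [b] ++ v := by
    intro m
    induction m with
    | zero => exact ⟨u, v, hu, hv, by simpa using huv⟩
    | succ m ih =>
      obtain ⟨u', v', hu', hv', h⟩ := ih
      refine ⟨f^[k] u' ++ u, v ++ f^[k] v', ?_, ?_, ?_⟩
      · intro c hc
        rcases List.mem_append.1 hc with hc | hc
        exacts [hu'.iterate hf k c hc, hu c hc]
      · intro c hc
        rcases List.mem_append.1 hc with hc | hc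
        exacts [hv c hc, hv'.iterate hf k c hc]
      · rw [show k * (m + 1 + 1) = k + k * (m + 1) by ring, Function.iterate_add_apply, h,
          hf.iterate k, hf.iterate k, huv]
        simp
  obtain ⟨U, V, hU, hV, hUV⟩ := hiter (M - 1)
  rw [Nat.sub_add_cancel hM] at hUV
  -- A multiple of `k`, so that `b` reproduces itself, and of `M`, so that images of non-growing
  -- words are fixed.
  set K := k * M with hK
  have hstat : ∀ w, NonGrowing f w → f^[K] (f^[K] w) = f^[K] w := by
    intro w hw'
    rw [← Function.iterate_add_apply, show K + K = M * (k + k) by rw [hK]; ring,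
      hw w hw' _ (by omega), hK, mul_comm, hw w hw' _ hk]
  have hpow : ∀ m, f^[K * (m + 1)] [b] = (List.replicate m (f^[K] U)).flatten ++ U ++ [b] ++
      V ++ (List.replicate m (f^[K] V)).flatten := by
    have hrep : ∀ w, NonGrowing f w → ∀ m, f^[K] (List.replicate m (f^[K] w)).flatten =
        (List.replicate m (f^[K] w)).flatten := by
      intro w hw' m
      induction m with
      | zero => simp [(hf.iterate K).nil]
      | succ m ih => simp [List.replicate_succ, hf.iterate K _ _, ih, hstat w hw']
    intro m
    induction m with
    | zero => simp [hUV]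
    | succ m ih =>
      rw [show K * (m + 1 + 1) = K + K * (m + 1) by ring, Function.iterate_add_apply, ih]
      simp only [hf.iterate K _ _, hUV, hrep U hU, hrep V hV]
      rw [List.replicate_succ', List.replicate_succ]
      simp
  -- The two stationary words cannot both vanish: the iterates of `b` with exponents `K` and `2 * K`
  -- would then coincide.
  by_cases hV0 : f^[K] V = []
  · refine ⟨f^[K] U, fun hU0 => ?_, fun m => ⟨K * (m + 1), ?_⟩⟩
    · have h0 := hpow 0
      have h1 := hpow 1
      simp only [hU0, hV0] at h0 h1
      have : K * (0 + 1) = K * (1 + 1) := hb (h0.trans (by simpa using h1.symm))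
      have hK0 : 0 < K := by positivity
      omega
    · rw [hpow]
      simp only [List.append_assoc]
      exact List.infix_append' [] _ _
  · refine ⟨f^[K] V, hV0, fun m => ⟨K * (m + 1), ?_⟩⟩
    rw [hpow]
    exact List.infix_append_right

end Growing

/-! ### A language-preserving morphism with a growing letter -/

section Growth

variable {A : Type*} [TopologicalSpace A] [DiscreteTopology A] [Finite A]

/-- The words of a minimal shift space contain arbitrarily many occurrences of each letter. -/
theorem IsMinimal.exists_le_count [DecidableEq A] {X : Subshift A ℤ} (hX : IsMinimal X) {d : A}
    (hd : [d] ∈ lang X) (n : ℕ) : ∃ z ∈ lang X, n ≤ z.count d := by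
  obtain ⟨N, hN⟩ := hX.exists_infix_of_le_length hd
  induction n with
  | zero => exact ⟨[d], hd, by simp⟩
  | succ n ih =>
    obtain ⟨z, hz, hn⟩ := ih
    obtain ⟨u, v, hu, -, h⟩ := exists_mem_append_of_mem_lang hz N
    have hdu := hN u (lang_of_infix ⟨[], z ++ v, by simp⟩ h) hu.ge
    refine ⟨_, h, ?_⟩
    have : 0 < u.count d := List.count_pos_iff.2 (hdu.subset (List.mem_singleton_self d))
    simp only [List.count_append]
    omega

/-- Without growing letters every exponent reduces to one below `M + M`, so iterated images of
letters have bounded length, but a point has factors of every length. -/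
theorem exists_growing_of_nonempty {σ : FreeMonoid A →* FreeMonoid A}
    (h : (shiftSpace σ).carrier.Nonempty) : ∃ c, Growing (wordMap σ) c := by
  by_contra! hc
  obtain ⟨M, hM, hw⟩ := exists_iterate_mul_eq (isMorph_wordMap σ)
  obtain ⟨x, hx⟩ := h
  have hfin : (Set.range fun p : A × Fin (M + M) => ((wordMap σ)^[p.2] [p.1]).length).Finite :=
    Set.finite_range _
  obtain ⟨L, hL⟩ := hfin.bddAbove
  obtain ⟨n, a, hn⟩ := mem_language.1 (hx 0 (L + 1))
  have hle := hn.length_le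
  rw [length_factor] at hle
  have hred : ∃ m : Fin (M + M), (wordMap σ)^[n] [a] = (wordMap σ)^[m] [a] := by
    rcases lt_or_ge n (M + M) with h | h
    · exact ⟨⟨n, h⟩, rfl⟩
    · have hlt : M + n % M < M + M := by
        have := Nat.mod_lt n hM
        omega
      refine ⟨⟨M + n % M, hlt⟩, ?_⟩
      have hdiv : 0 < n / M := Nat.div_pos (by omega) hM
      change (wordMap σ)^[n] [a] = (wordMap σ)^[M + n % M] [a]
      conv_lhs => rw [← Nat.mod_add_div n M, Function.iterate_add_apply,
        hw [a] (fun c _ => hc c) _ hdiv, ← Function.iterate_add_apply, add_comm]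
  obtain ⟨m, hm⟩ := hred
  rw [hm] at hle
  have := hL ⟨(a, m), rfl⟩
  simp only at this
  omega

/-- If the image of a growing letter has growing letters in three places, then some growing letter
occurs in the shift space. -/
theorem exists_growing_mem_lang {σ : FreeMonoid A →* FreeMonoid A} {b : A} {k : ℕ}
    {P Q R : List A} (h : (wordMap σ)^[k] [b] = P ++ Q ++ R)
    (hP : ∃ c ∈ P, Growing (wordMap σ) c) (hQ : ∃ c ∈ Q, Growing (wordMap σ) c)
    (hR : ∃ c ∈ R, Growing (wordMap σ) c) :
    ∃ d, Growing (wordMap σ) d ∧ [d] ∈ lang (shiftSpace σ) := by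
  have hσ := isMorph_wordMap σ
  obtain ⟨p, hpP, hp⟩ := hP
  obtain ⟨q, hqQ, hq⟩ := hQ
  obtain ⟨r, hrR, hr⟩ := hR
  -- Images of `Q` keep a growing letter while those of `P` and `R` become long. The letter depends
  -- on `n`; finiteness of the alphabet then yields one that works for all `n`.
  have key : ∀ n : ℕ, ∃ d, Growing (wordMap σ) d ∧ ∃ u v : List A, n ≤ u.length ∧ n ≤ v.length ∧
      u ++ [d] ++ v ∈ language σ := by
    intro n
    obtain ⟨n₁, h₁⟩ := hp.exists_le_length_of_mem hσ hpP n
    obtain ⟨n₂, h₂⟩ := hr.exists_le_length_of_mem hσ hrR n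
    have h₁' := h₁ (n₁ + n₂) (by omega)
    have h₂' := h₂ (n₁ + n₂) (by omega)
    obtain ⟨d, hd, hgr⟩ := hq.not_nonGrowing_of_mem hσ hqQ (n₁ + n₂)
    obtain ⟨s, t, hst⟩ := List.append_of_mem hd
    refine ⟨d, hgr, (wordMap σ)^[n₁ + n₂] P ++ s, t ++ (wordMap σ)^[n₁ + n₂] R, ?_, ?_, ?_⟩
    · simp only [List.length_append]; omega
    · simp only [List.length_append]; omega
    · refine mem_language.2 ⟨n₁ + n₂ + k, b, ?_⟩
      rw [Function.iterate_add_apply _ (n₁ + n₂) k, h, hσ.iterate _ _ _, hσ.iterate _ _ _, hst]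
      simp
  by_contra! hcon
  have hfail : ∀ d : A, ∃ n : ℕ, Growing (wordMap σ) d → ∀ u v : List A, n ≤ u.length →
      n ≤ v.length → u ++ [d] ++ v ∉ language σ := by
    intro d
    by_contra! hd
    refine hcon d (hd 0).1 (mem_lang_of_forall_extension fun n => (hd n).2)
  choose n hn using hfail
  have := Fintype.ofFinite A
  obtain ⟨d, hgr, u, v, hu, hv, huv⟩ := key (Finset.univ.sup n)
  have hle : n d ≤ Finset.univ.sup n := Finset.le_sup (Finset.mem_univ d)
  exact hn d hgr u v (hle.trans hu) (hle.trans hv) huv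

/-- If a growing letter occurs in a minimal substitution shift, then the language of the shift is
invariant under the substitution. -/
theorem wordMap_mem_lang {σ : FreeMonoid A →* FreeMonoid A} (hX : IsMinimal (shiftSpace σ))
    {d : A} (hd : Growing (wordMap σ) d) (hdX : [d] ∈ lang (shiftSpace σ)) {w : List A}
    (hw : w ∈ lang (shiftSpace σ)) : wordMap σ w ∈ lang (shiftSpace σ) := by
  classical
  have hσ := isMorph_wordMap σ
  have hd0 : wordMap σ [d] ≠ [] := by
    intro h0
    refine hd.not_nonGrowing hσ 1 fun c hc => ?_
    rw [Function.iterate_one, h0] at hc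
    simp at hc
  refine mem_lang_of_forall_extension fun n => ?_
  -- Long words contain `z`, hence at least `n` copies of the unerased letter `d`, so their images
  -- have length at least `n`.
  obtain ⟨z, hz, hzn⟩ := hX.exists_le_count hdX n
  obtain ⟨N, hN⟩ := hX.exists_infix_of_le_length hz
  obtain ⟨u, v, hu, hv, h⟩ := exists_mem_append_of_mem_lang hw N
  have hlong : ∀ u ∈ lang (shiftSpace σ), u.length = N → n ≤ (wordMap σ u).length := by
    intro u hu hlen
    exact hzn.trans ((hσ.count_le_length hd0 z).trans (hσ.infix (hN u hu hlen.ge)).length_le)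
  refine ⟨wordMap σ u, wordMap σ v, hlong u (lang_of_infix ⟨[], w ++ v, by simp⟩ h) hu,
    hlong v (lang_of_infix ⟨u ++ w, [], by simp⟩ h) hv, ?_⟩
  rw [← hσ, ← hσ]
  exact wordMap_mem_language (language_of_lang h)

/-- The powers of a word, if they belong to the language of `σ`, occur in its shift space. -/
theorem replicate_mem_lang {σ : FreeMonoid A →* FreeMonoid A} {t : List A} (ht : t ≠ [])
    (h : ∀ m : ℕ, (List.replicate m t).flatten ∈ language σ) (m : ℕ) :
    (List.replicate m t).flatten ∈ lang (shiftSpace σ) := by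
  refine mem_lang_of_forall_extension fun n =>
    ⟨(List.replicate n t).flatten, (List.replicate n t).flatten, ?_, ?_, ?_⟩
  · simpa using Nat.le_mul_of_pos_right n (List.length_pos_iff.2 ht)
  · simpa using Nat.le_mul_of_pos_right n (List.length_pos_iff.2 ht)
  · rw [← List.flatten_append, ← List.flatten_append, List.replicate_append_replicate,
      List.replicate_append_replicate]
    exact h _

/-- The language of a minimal substitution shift is invariant under some substitution for which
the lengths of the iterated images of one of its letters are unbounded. -/
theorem IsMinimal.exists_isMorph {σ : FreeMonoid A →* FreeMonoid A}
    (hX : IsMinimal (shiftSpace σ)) :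
    ∃ (f : List A → List A) (a : A), IsMorph f ∧
      (∀ w ∈ lang (shiftSpace σ), f w ∈ lang (shiftSpace σ)) ∧ [a] ∈ lang (shiftSpace σ) ∧
      ∀ N, ∃ n, N ≤ (f^[n] [a]).length := by
  have hσ := isMorph_wordMap σ
  by_cases hgr : ∃ d, Growing (wordMap σ) d ∧ [d] ∈ lang (shiftSpace σ)
  · obtain ⟨d, hd, hdX⟩ := hgr
    refine ⟨wordMap σ, d, hσ, fun w => wordMap_mem_lang hX hd hdX, hdX, fun N => ?_⟩
    obtain ⟨n, hn⟩ := hd.exists_le_length N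
    exact ⟨n, hn n le_rfl⟩
  · obtain ⟨c, hc⟩ := exists_growing_of_nonempty hX.1
    obtain ⟨b, k, hb, hk, hbk⟩ := hc.exists_recurrent hσ
    obtain ⟨u, v, huv⟩ := List.append_of_mem hbk
    replace huv : (wordMap σ)^[k] [b] = u ++ [b] ++ v := by simpa using huv
    have hsq : (wordMap σ)^[k + k] [b] =
        (wordMap σ)^[k] u ++ (u ++ [b] ++ v) ++ (wordMap σ)^[k] v := by
      rw [Function.iterate_add_apply, huv, hσ.iterate _ _ _, hσ.iterate _ _ _, huv]
    -- A growing letter in `u` would give three growing places in the image under the exponent `k +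
    -- k`: in the image of `u`, in `u` and at `b`.
    have hu : NonGrowing (wordMap σ) u := by
      intro d hd hdg
      refine hgr (exists_growing_mem_lang (P := (wordMap σ)^[k] u) (Q := u)
        (R := [b] ++ v ++ (wordMap σ)^[k] v) (hsq.trans (by simp))
        (hdg.not_nonGrowing_of_mem hσ hd k) ⟨d, hd, hdg⟩ ⟨b, by simp, hb⟩)
    have hv : NonGrowing (wordMap σ) v := by
      intro d hd hdg
      refine hgr (exists_growing_mem_lang (P := (wordMap σ)^[k] u ++ u ++ [b]) (Q := v)
        (R := (wordMap σ)^[k] v) (hsq.trans (by simp)) ⟨b, by simp, hb⟩ ⟨d, hd, hdg⟩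
        (hdg.not_nonGrowing_of_mem hσ hd k))
    obtain ⟨t, ht, hpow⟩ := hb.exists_powers hσ hk huv hu hv
    have hlang := replicate_mem_lang (σ := σ) ht fun m => mem_language.2 <| by
      obtain ⟨n, hn⟩ := hpow m
      exact ⟨n, b, hn⟩
    -- All values are powers of `t`, hence in the language; the factor 2 forces growth even if `t`
    -- is a single letter.
    let f : List A → List A := fun w => (List.replicate (2 * w.length) t).flatten
    have hlen : ∀ w, 2 * w.length ≤ (f w).length := fun w => by
      simpa [f] using Nat.le_mul_of_pos_right (2 * w.length) (List.length_pos_iff.2 ht)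
    refine ⟨f, t.head ht, fun u v => ?_, fun w _ => hlang _, ?_, fun N => ⟨N, ?_⟩⟩
    · simp only [f]
      rw [← List.flatten_append, List.replicate_append_replicate, List.length_append, mul_add]
    · refine lang_of_infix (List.IsPrefix.isInfix ⟨t.tail, by simp⟩) (hlang 1)
    · have : ∀ n, n + 1 ≤ (f^[n] [t.head ht]).length := by
        intro n
        induction n with
        | zero => simp
        | succ n ih =>
          rw [Function.iterate_succ_apply']
          have := hlen (f^[n] [t.head ht])
          omega
      exact (Nat.le_succ N).trans (this N)

end Growth

/-! ### Return words and the tower coding -/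

section ReturnWords

variable {A I : Type*}

/-- The letters of the tower over the words `θ i`: a position inside one of these words. -/
abbrev Tower (θ : I → List A) : Type _ := Σ i : I, Fin (θ i).length

/-- The concatenation of the words `θ i`, for `i` in a list. -/
def spell (θ : I → List A) (l : List I) : List A := l.flatMap θ

/-- The word over the tower that lists the positions of `spell θ l`. -/
def code (θ : I → List A) (l : List I) : List (Tower θ) :=
  l.flatMap fun i => List.ofFn fun k : Fin (θ i).length => (⟨i, k⟩ : Tower θ)

variable {θ : I → List A}

theorem spell_cons (i : I) (l : List I) : spell θ (i :: l) = θ i ++ spell θ l := by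
  simp [spell]

theorem code_cons (i : I) (l : List I) :
    code θ (i :: l) = (List.ofFn fun k : Fin (θ i).length => (⟨i, k⟩ : Tower θ)) ++ code θ l := by
  simp [code]

theorem isMorph_code : IsMorph (code θ) := fun u v => by simp [code]

theorem mem_code {b : Tower θ} {l : List I} : b ∈ code θ l ↔ b.1 ∈ l := by
  obtain ⟨i, k⟩ := b
  simp only [code, List.mem_flatMap, List.mem_ofFn]
  constructor
  · rintro ⟨j, hj, k', h⟩
    cases h
    exact hj
  · intro h
    exact ⟨i, h, k, rfl⟩

/-- The position `j` of `x` lies in an occurrence of a word `θ i` followed by the letter `a`, at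
the place recorded by `b`. -/
def Covers (θ : I → List A) (a : A) (x : ℤ → A) (j : ℤ) (b : Tower θ) : Prop :=
  factor x (j - (b.2 : ℕ)) ((θ b.1).length + 1) = θ b.1 ++ [a]

theorem covers_shift {a : A} {x : ℤ → A} {g j : ℤ} {b : Tower θ} :
    Covers θ a (shift g x) j b ↔ Covers θ a x (g + j) b := by
  rw [Covers, Covers, factor_shift, add_sub_assoc]

/-- The occurrence and its closing `a` lie within distance `K` of the position, so the coding is
local. -/
theorem Covers.congr {a : A} {x y : ℤ → A} {i j : ℤ} {b : Tower θ} (h : Covers θ a x j b) {K : ℕ}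
    (hK : (θ b.1).length ≤ K)
    (hxy : factor x (j - K) (K + K + 1) = factor y (i - K) (K + K + 1)) : Covers θ a y i b := by
  rw [Covers, ← h, factor_eq_factor_iff]
  rw [factor_eq_factor_iff] at hxy
  intro m hm
  have hb := b.2.2
  have := hxy (K - b.2 + m) (by omega)
  rw [show j - K + ((K - b.2 + m : ℕ) : ℤ) = j - (b.2 : ℕ) + m by omega,
    show i - K + ((K - b.2 + m : ℕ) : ℤ) = i - (b.2 : ℕ) + m by omega] at this
  exact this.symm

variable [TopologicalSpace A] {X : Subshift A ℤ} {a : A}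

/-- The words `θ i` are the return words to the letter `a` in the shift space `X`. -/
structure IsReturnSystem (X : Subshift A ℤ) (a : A) (θ : I → List A) : Prop where
  injective : Function.Injective θ
  exists_eq_cons : ∀ i, ∃ u, θ i = a :: u ∧ a ∉ u
  append_mem : ∀ i, θ i ++ [a] ∈ lang X
  exists_eq : ∀ u, a ∉ u → a :: u ++ [a] ∈ lang X → ∃ i, θ i = a :: u

theorem IsReturnSystem.length_pos (H : IsReturnSystem X a θ) (i : I) : 0 < (θ i).length := by
  obtain ⟨u, hu, -⟩ := H.exists_eq_cons i
  simp [hu]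

theorem IsReturnSystem.length_le_length_spell (H : IsReturnSystem X a θ) (l : List I) :
    l.length ≤ (spell θ l).length := by
  induction l with
  | nil => simp
  | cons i l ih =>
    have := H.length_pos i
    simp only [spell_cons, List.length_cons, List.length_append]
    omega

theorem IsReturnSystem.count_spell [DecidableEq A] (H : IsReturnSystem X a θ) (l : List I) :
    (spell θ l).count a = l.length := by
  induction l with
  | nil => simp [spell]
  | cons i l ih =>
    obtain ⟨u, hu, hau⟩ := H.exists_eq_cons i
    rw [spell_cons, List.count_append, ih, hu, List.count_cons_self,
      List.count_eq_zero_of_not_mem hau, List.length_cons]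
    omega

theorem IsReturnSystem.covers_apply (H : IsReturnSystem X a θ) {x : ℤ → A} {j : ℤ} {b : Tower θ}
    (h : Covers θ a x j b) :
    x (j - (b.2 : ℕ)) = a ∧ x (j - (b.2 : ℕ) + (θ b.1).length) = a ∧
      ∀ m : ℕ, 0 < m → m < (θ b.1).length → x (j - (b.2 : ℕ) + m) ≠ a := by
  obtain ⟨u, hu, hau⟩ := H.exists_eq_cons b.1
  unfold Covers at h
  generalize j - ((b.2 : ℕ) : ℤ) = s at h ⊢
  obtain ⟨h1, h2⟩ := factor_eq_append h
  refine ⟨?_, ?_, ?_⟩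
  · rw [hu, List.length_cons, factor_succ] at h1
    exact (List.cons.inj h1).1
  · simpa [factor_one] using h2
  · intro m hm hm' ha
    rw [hu, List.length_cons, factor_succ] at h1
    refine hau ?_
    rw [← (List.cons.inj h1).2, mem_factor]
    rw [hu, List.length_cons] at hm'
    refine ⟨m - 1, by omega, ?_⟩
    rw [← ha]
    congr 1
    omega

/-- The last `a` at or before `j` and the first one after `j` determine the return word and the
place in it. -/
theorem IsReturnSystem.covers_unique (H : IsReturnSystem X a θ) {x : ℤ → A} {j : ℤ}
    {b c : Tower θ} (hb : Covers θ a x j b) (hc : Covers θ a x j c) : b = c := by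
  obtain ⟨b1, b2, b3⟩ := H.covers_apply hb
  obtain ⟨c1, c2, c3⟩ := H.covers_apply hc
  have lb := b.2.2
  have lc := c.2.2
  have hk : (b.2 : ℕ) = c.2 := by
    rcases lt_trichotomy (b.2 : ℕ) c.2 with h | h | h
    · refine absurd ?_ (c3 (c.2 - b.2) (by omega) (by omega))
      rw [← b1]; congr 1; omega
    · exact h
    · refine absurd ?_ (b3 (b.2 - c.2) (by omega) (by omega))
      rw [← c1]; congr 1; omega
  have hl : (θ b.1).length = (θ c.1).length := by
    rcases lt_trichotomy (θ b.1).length (θ c.1).length with h | h | h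
    · refine absurd ?_ (c3 (θ b.1).length (by omega) h)
      rw [← b2, hk]
    · exact h
    · refine absurd ?_ (b3 (θ c.1).length (by omega) h)
      rw [← c2, hk]
  have hi : b.1 = c.1 := by
    apply H.injective
    have : θ b.1 ++ [a] = θ c.1 ++ [a] := by rw [← hb, ← hc, hk, hl]
    exact List.append_cancel_right this
  obtain ⟨i, k⟩ := b
  obtain ⟨i', k'⟩ := c
  cases hi
  simp only at hk
  rw [Fin.ext hk]

/-- Cut before each `a`. The condition on `head?` allows `w` to be empty or to begin with `a`, which
is what the induction needs. -/
theorem IsReturnSystem.exists_spell_eq (H : IsReturnSystem X a θ) (w : List A)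
    (ha : (w ++ [a]).head? = some a) (hw : w ++ [a] ∈ lang X) : ∃ l, spell θ l = w := by
  classical
  induction hn : w.length using Nat.strong_induction_on generalizing w with
  | _ n ih =>
  rcases w with _ | ⟨c, w⟩
  · exact ⟨[], rfl⟩
  obtain rfl : c = a := by simpa using ha
  obtain ⟨u, v, huv, hu, hv⟩ : ∃ u v, w = u ++ v ∧ c ∉ u ∧ (v ++ [c]).head? = some c := by
    by_cases hc : c ∈ w
    · obtain ⟨u, v, h1, h2⟩ := List.eq_append_cons_of_mem hc
      exact ⟨u, c :: v, h1, h2, by simp⟩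
    · exact ⟨w, [], by simp, hc, by simp⟩
  obtain ⟨v', hv'⟩ := List.head?_eq_some_iff.1 hv
  obtain ⟨i, hi⟩ := H.exists_eq u hu (lang_of_infix ⟨[], v', by simp [huv, hv']⟩ hw)
  obtain ⟨l, hl⟩ := ih v.length (by rw [← hn, huv]; simp) v hv
    (lang_of_infix ⟨c :: u, [], by simp [huv]⟩ hw) rfl
  exact ⟨i :: l, by rw [spell_cons, hl, hi, huv]; simp⟩

theorem IsReturnSystem.head?_spell_append (H : IsReturnSystem X a θ) (l : List I) :
    (spell θ l ++ [a]).head? = some a := by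
  rcases l with _ | ⟨i, l⟩
  · simp [spell]
  · obtain ⟨u, hu, -⟩ := H.exists_eq_cons i
    simp [spell_cons, hu]

/-- The coding of an occurrence of `spell θ l` followed by `a`. -/
theorem IsReturnSystem.factor_eq_code (H : IsReturnSystem X a θ) {x : ℤ → A} {y : ℤ → Tower θ}
    (hy : ∀ j, Covers θ a x j (y j)) {l : List I} {i : ℤ}
    (h : factor x i ((spell θ l).length + 1) = spell θ l ++ [a]) :
    factor y i (spell θ l).length = code θ l := by
  induction l generalizing i with
  | nil => simp [spell, code, factor]
  | cons r l ih =>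
    simp only [spell_cons, List.append_assoc, List.length_append] at h ⊢
    obtain ⟨h1, h2⟩ := factor_eq_append h
    rw [List.length_append, List.length_singleton] at h2
    rw [factor_add, ih h2, code_cons]
    congr 1
    have hx : x (i + (θ r).length) = a := by
      have := H.head?_spell_append (θ := θ) l
      rw [← h2, factor_succ] at this
      simpa using this
    apply List.ext_getElem (by simp)
    intro k hk hk'
    simp only [factor, List.getElem_ofFn]
    refine H.covers_unique (hy _) ?_
    rw [Covers]
    simp only [add_sub_cancel_right]
    rw [factor_add, h1, factor_one, hx]

/-- A concatenation of return words that occurs in another one is coded by a factor of its code. -/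
theorem IsReturnSystem.code_infix_code (H : IsReturnSystem X a θ)
    (hcov : ∀ x ∈ X.carrier, ∀ j, ∃ b, Covers θ a x j b) {l m : List I}
    (hlm : spell θ l ++ [a] <:+: spell θ m ++ [a]) (hm : spell θ m ++ [a] ∈ lang X) :
    code θ l <:+: code θ m := by
  obtain ⟨x, hx, i, hi⟩ := hm
  choose y hy using hcov x hx
  rw [← hi] at hlm
  obtain ⟨k, hk, hk'⟩ := exists_factor_of_infix hlm
  simp only [List.length_append, List.length_singleton] at hi hk hk'
  rw [← H.factor_eq_code hy hk', ← H.factor_eq_code hy hi]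
  exact factor_infix_factor y i (by omega)

variable [DiscreteTopology A] [Finite A]

theorem IsMinimal.exists_covers (hX : IsMinimal X) (H : IsReturnSystem X a θ)
    (ha : [a] ∈ lang X) {x : ℤ → A} (hx : x ∈ X.carrier) (j : ℤ) : ∃ b, Covers θ a x j b := by
  obtain ⟨N, hN⟩ := hX.exists_infix_of_le_length ha
  have hocc : ∀ i : ℤ, ∃ k : ℕ, k < N ∧ x (i + k) = a := fun i =>
    mem_factor.1 ((hN _ (factor_mem_lang hx i N) (by simp)).subset (List.mem_singleton_self a))
  -- The return word covering `j` runs from the last `a` at or before `j` to the first `a` after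
  -- `j`; bounded gaps provide both.
  obtain ⟨s, ⟨hsj, hs⟩, hsmax⟩ : ∃ s : ℤ, (s ≤ j ∧ x s = a) ∧ ∀ z, z ≤ j ∧ x z = a → z ≤ s := by
    refine Int.exists_greatest_of_bdd ⟨j, fun z hz => hz.1⟩ ?_
    obtain ⟨k, hk, hk'⟩ := hocc (j - N)
    exact ⟨_, by omega, hk'⟩
  obtain ⟨e, ⟨hje, he⟩, hemin⟩ : ∃ e : ℤ, (j < e ∧ x e = a) ∧ ∀ z, j < z ∧ x z = a → e ≤ z := by
    refine Int.exists_least_of_bdd ⟨j, fun z hz => hz.1.le⟩ ?_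
    obtain ⟨k, hk, hk'⟩ := hocc (j + 1)
    exact ⟨_, by omega, hk'⟩
  obtain ⟨n, hn⟩ := Int.le.dest (show s + 1 ≤ e by omega)
  have hfac : factor x s (n + 1 + 1) = a :: factor x (s + 1) n ++ [a] := by
    rw [factor_succ, factor_add, factor_one, hs, hn, he, List.cons_append]
  obtain ⟨i, hi⟩ := H.exists_eq (factor x (s + 1) n) (by
    rw [mem_factor]
    rintro ⟨k, hk, hk'⟩
    rcases le_or_gt (s + 1 + k) j with h | h
    · have := hsmax _ ⟨h, hk'⟩
      omega
    · have := hemin _ ⟨h, hk'⟩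
      omega) (by rw [← hfac]; exact factor_mem_lang hx _ _)
  have hlen : (θ i).length = n + 1 := by rw [hi]; simp
  refine ⟨⟨i, ⟨(j - s).toNat, by omega⟩⟩, ?_⟩
  rw [Covers]
  simp only [hlen]
  rw [hi, ← hfac]
  congr 1
  omega

theorem IsMinimal.exists_isReturnSystem (hX : IsMinimal X) (ha : [a] ∈ lang X) :
    ∃ (N : ℕ) (θ : Fin N → List A), IsReturnSystem X a θ := by
  obtain ⟨N, hN⟩ := hX.exists_infix_of_le_length ha
  have hfin : Finite {r : List A // ∃ u, r = a :: u ∧ a ∉ u ∧ r ++ [a] ∈ lang X} := by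
    refine ((List.finite_length_le A N).subset ?_).to_subtype
    rintro r ⟨u, rfl, hu, hr⟩
    by_contra! hlt
    have hlt' : N < (a :: u).length := by simpa using hlt
    refine hu ((hN u (lang_of_infix ⟨[a], [a], by simp⟩ hr) ?_).subset (List.mem_singleton_self a))
    rw [List.length_cons] at hlt'
    omega
  let e := Finite.equivFin {r : List A // ∃ u, r = a :: u ∧ a ∉ u ∧ r ++ [a] ∈ lang X}
  refine ⟨_, fun i => (e.symm i).1, ?_, ?_, ?_, ?_⟩
  · exact Subtype.val_injective.comp e.symm.injective
  · intro i
    obtain ⟨u, hu, hau, -⟩ := (e.symm i).2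
    exact ⟨u, hu, hau⟩
  · intro i
    obtain ⟨u, -, -, h⟩ := (e.symm i).2
    exact h
  · intro u hu h
    exact ⟨e ⟨a :: u, u, rfl, hu, h⟩, by simp⟩

end ReturnWords

/-- All blocks but the last are single letters. This distributes `D i` over the positions of `θ i`.
-/
theorem exists_ofFn_flatten_eq {I : Type*} {n : ℕ} (hn : 0 < n) {l : List I} (hl : n ≤ l.length) :
    ∃ E : Fin n → List I, (∀ k, E k ≠ []) ∧ (List.ofFn E).flatten = l := by
  induction n, hn using Nat.le_induction generalizing l with
  | base =>
    refine ⟨fun _ => l, fun _ => List.length_pos_iff.1 hl, by simp⟩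
  | succ n hn ih =>
    rcases l with _ | ⟨c, l⟩
    · simp at hl
    · obtain ⟨E, hE, hEl⟩ := ih (l := l) (by simpa using hl)
      refine ⟨Fin.cons [c] E, fun k => ?_, by simp [List.ofFn_succ, hEl]⟩
      refine Fin.cases (by simp) (fun k => by simpa using hE k) k

/-! ### The substitutions on return words and on the tower -/

section Derived

variable {A I : Type*} {θ : I → List A}

/-- The substitution on the tower under which the positions of `θ i` have the images coded by the
lists `E i k`. -/
def towerSubst (θ : I → List A) (E : ∀ i, Fin (θ i).length → List I) :
    FreeMonoid (Tower θ) →* FreeMonoid (Tower θ) :=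
  FreeMonoid.lift fun b => FreeMonoid.ofList (code θ (E b.1 b.2))

theorem wordMap_towerSubst_singleton (E : ∀ i, Fin (θ i).length → List I) (b : Tower θ) :
    wordMap (towerSubst θ E) [b] = code θ (E b.1 b.2) := by
  have : FreeMonoid.ofList [b] = FreeMonoid.of b := rfl
  simp [wordMap, towerSubst, this]

/-- The blocks over the positions of `θ i` join to `D i`, so on codes of whole return words the cuts
are invisible and the substitution acts as `D`. -/
theorem wordMap_towerSubst_code {E : ∀ i, Fin (θ i).length → List I} {D : I → List I}
    (hE : ∀ i, (List.ofFn (E i)).flatten = D i) (l : List I) :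
    wordMap (towerSubst θ E) (code θ l) = code θ (l.flatMap D) := by
  have hτ := isMorph_wordMap (towerSubst θ E)
  have hflat : ∀ w : List (Tower θ), wordMap (towerSubst θ E) w =
      code θ (w.flatMap fun b => E b.1 b.2) := by
    intro w
    induction w with
    | nil => simp [hτ.nil, code]
    | cons b w ih =>
      rw [hτ.cons, ih, wordMap_towerSubst_singleton, List.flatMap_cons, isMorph_code]
  rw [hflat]
  congr 1
  induction l with
  | nil => rfl
  | cons i l ih =>
    rw [code_cons, List.flatMap_append, ih, List.flatMap_cons, ← hE i]
    congr 1
    simp [List.flatMap, List.map_ofFn, Function.comp_def]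

theorem wordMap_towerSubst_iterate_code {E : ∀ i, Fin (θ i).length → List I} {D : I → List I}
    (hE : ∀ i, (List.ofFn (E i)).flatten = D i) (n : ℕ) (l : List I) :
    (wordMap (towerSubst θ E))^[n] (code θ l) =
      code θ ((fun l : List I => l.flatMap D)^[n] l) := by
  induction n generalizing l with
  | zero => rfl
  | succ n ih =>
    rw [Function.iterate_succ_apply, wordMap_towerSubst_code hE, ih, Function.iterate_succ_apply]

/-- If `T θ(i)` is conjugate to `spell θ (D i)` by `p`, so are their concatenations. -/
theorem append_spell_flatMap {T : List A → List A} (hT : IsMorph T) {p : List A}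
    {D : I → List I} (hD : ∀ i, p ++ spell θ (D i) = T (θ i) ++ p) (l : List I) :
    p ++ spell θ (l.flatMap D) = T (spell θ l) ++ p := by
  induction l with
  | nil => simp [spell, hT.nil]
  | cons i l ih =>
    have : spell θ ((i :: l).flatMap D) = spell θ (D i) ++ spell θ (l.flatMap D) := by
      simp [spell]
    rw [this, ← List.append_assoc, hD, List.append_assoc, ih, spell_cons, hT, List.append_assoc]

variable [TopologicalSpace A] {X : Subshift A ℤ} {a : A}

/-- By conjugation, `T` maps `spell θ l ++ [a]` to `p`, then `spell θ (l.flatMap D)`, then `a` and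
`s`; stripping `p` and `s` stays in the language. -/
theorem spell_iterate_mem_lang {T : List A → List A} (hT : IsMorph T)
    (hTX : ∀ w ∈ lang X, T w ∈ lang X) {p s : List A} (ha : T [a] = p ++ a :: s)
    {D : I → List I} (hD : ∀ i, p ++ spell θ (D i) = T (θ i) ++ p) {l : List I}
    (hl : spell θ l ++ [a] ∈ lang X) (n : ℕ) :
    spell θ ((fun l : List I => l.flatMap D)^[n] l) ++ [a] ∈ lang X := by
  induction n generalizing l with
  | zero => exact hl
  | succ n ih =>
    rw [Function.iterate_succ_apply]
    refine ih (lang_of_infix ⟨p, s, ?_⟩ (hTX _ hl))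
    rw [hT, ha, ← List.append_assoc p, append_spell_flatMap hT hD]
    simp

variable [DiscreteTopology A] [Finite A] [Finite I]

/-- A power `T` of `f` has an image `T [a] = p a s` and induces, after conjugation by `p`, a
substitution `D` on return words; one can choose `T` such that the images under `D` are long and
contain all return words. -/
theorem IsMinimal.exists_derived (hX : IsMinimal X) (H : IsReturnSystem X a θ)
    (ha : [a] ∈ lang X) {f : List A → List A} (hf : IsMorph f)
    (hfX : ∀ w ∈ lang X, f w ∈ lang X) (hgr : ∀ N, ∃ n, N ≤ (f^[n] [a]).length) :
    ∃ (T : List A → List A) (p s : List A) (D : I → List I), IsMorph T ∧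
      (∀ w ∈ lang X, T w ∈ lang X) ∧ T [a] = p ++ a :: s ∧
      (∀ i, p ++ spell θ (D i) = T (θ i) ++ p) ∧
      (∀ i, 2 ≤ (D i).length ∧ (θ i).length ≤ (D i).length) ∧ ∀ i j, j ∈ D i := by
  classical
  have := Fintype.ofFinite I
  choose N hN using fun i => hX.exists_infix_of_le_length (H.append_mem i)
  -- Each `a` starts a return word, so a spelling that contains `z` has enough entries for both
  -- length bounds.
  obtain ⟨z, hz, hzc⟩ := hX.exists_le_count ha (2 + Finset.univ.sup fun i => (θ i).length)
  obtain ⟨N₁, hN₁⟩ := hX.exists_infix_of_le_length hz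
  obtain ⟨N₂, hN₂⟩ := hX.exists_infix_of_le_length ha
  -- The summands secure every return word, the word `z`, and the letter `a` in the images.
  obtain ⟨n, hn⟩ := hgr (Finset.univ.sup N + N₁ + N₂)
  have hT := hf.iterate n
  have hTX : ∀ w ∈ lang X, f^[n] w ∈ lang X := by
    intro w hw
    clear hn hT
    induction n with
    | zero => exact hw
    | succ n ih => rw [Function.iterate_succ_apply']; exact hfX _ ih
  generalize f^[n] = T at hn hT hTX
  obtain ⟨p, s, hps⟩ := List.append_of_mem
    ((hN₂ _ (hTX _ ha) (by omega)).subset (List.mem_singleton_self a))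
  have hdec : ∀ i, ∃ l, p ++ spell θ l = T (θ i) ++ p ∧ spell θ l ++ [a] ∈ lang X := by
    intro i
    obtain ⟨u, hu, -⟩ := H.exists_eq_cons i
    have hTu : T (θ i) = p ++ a :: (s ++ T u) := by rw [hu, hT.cons, hps]; simp
    -- The image of `θ i ++ [a]` begins with `p ++ [a]` and ends with `p ++ a :: s`; removing the
    -- outer `p` and `s` leaves a word that begins and ends with `a`.
    have hmem : a :: (s ++ T u ++ p) ++ [a] ∈ lang X := by
      refine lang_of_infix ⟨p, s, ?_⟩ (hTX _ (H.append_mem i))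
      rw [hT, hTu, hps]
      simp
    obtain ⟨l, hl⟩ := H.exists_spell_eq _ (by simp) hmem
    exact ⟨l, by rw [hl, hTu]; simp, by rw [hl]; exact hmem⟩
  choose D hD hDX using hdec
  have hlen : ∀ i, Finset.univ.sup N + N₁ + N₂ ≤ (spell θ (D i)).length := by
    intro i
    obtain ⟨u, hu, -⟩ := H.exists_eq_cons i
    have h1 := congrArg List.length (hD i)
    rw [hu, hT.cons] at h1
    simp only [List.length_append] at h1
    omega
  have hDX' : ∀ i, spell θ (D i) ∈ lang X := fun i =>
    lang_of_infix ⟨[], [a], by simp⟩ (hDX i)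
  refine ⟨T, p, s, D, hT, hTX, hps, hD, fun i => ?_, fun i j => ?_⟩
  · have h1 := (hN₁ _ (hDX' i) (by have := hlen i; omega)).sublist.count_le a
    rw [H.count_spell] at h1
    have h2 : (θ i).length ≤ Finset.univ.sup fun i => (θ i).length :=
      Finset.le_sup (f := fun i => (θ i).length) (Finset.mem_univ i)
    omega
  · have h1 : N j ≤ Finset.univ.sup N := Finset.le_sup (Finset.mem_univ j)
    have h2 := hN j _ (hDX' i) (by have := hlen i; omega)
    -- An occurrence of `θ j ++ [a]` respects the cutting into return words, so `j` is an entry of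
    -- `D i`.
    have h3 : code θ [j] <:+: code θ (D i) := by
      refine H.code_infix_code (fun x hx => hX.exists_covers H ha hx) ?_ (hDX i)
      simpa [spell] using h2.trans (List.infix_append_left (l₂ := [a]))
    exact mem_code.1 (h3.subset (mem_code (b := ⟨j, ⟨0, H.length_pos j⟩⟩).2
      (List.mem_singleton_self j)))

end Derived

/-! ### Primitivity and conjugacy -/

section Conjugacy

variable {A I : Type*} {θ : I → List A} {a : A} {D : I → List I}
  {E : ∀ i, Fin (θ i).length → List I}

/-- Blocks are nonempty, so the image of any letter contains the code of a whole return word; the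
next image contains the codes of all return words. -/
theorem isPrimitive_towerSubst (hDE : ∀ i, (List.ofFn (E i)).flatten = D i)
    (hE : ∀ i k, E i k ≠ []) (hD : ∀ i j, j ∈ D i) : IsPrimitive (towerSubst θ E) := by
  refine ⟨2, by omega, fun b c => ?_⟩
  have hτ := isMorph_wordMap (towerSubst θ E)
  change c ∈ FreeMonoid.toList ((towerSubst θ E)^[2] (FreeMonoid.ofList [b]))
  rw [← wordMap_iterate]
  change c ∈ wordMap (towerSubst θ E) (wordMap (towerSubst θ E) [b])
  rw [wordMap_towerSubst_singleton, wordMap_towerSubst_code hDE, mem_code, List.mem_flatMap]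
  exact ⟨(E b.1 b.2).head (hE _ _), List.head_mem _, hD _ _⟩

variable [TopologicalSpace A] [DiscreteTopology A] [Finite A] [Finite I]
  {σ : FreeMonoid A →* FreeMonoid A}

/-- The shift space of `towerSubst θ E` consists of the codings of the points of the given shift
space. -/
theorem conjugate_towerSubst (hX : IsMinimal (shiftSpace σ))
    (H : IsReturnSystem (shiftSpace σ) a θ) (ha : [a] ∈ lang (shiftSpace σ))
    (hDX : ∀ l, spell θ l ++ [a] ∈ lang (shiftSpace σ) → ∀ n,
      spell θ ((fun l : List I => l.flatMap D)^[n] l) ++ [a] ∈ lang (shiftSpace σ))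
    (hD : ∀ i, 2 ≤ (D i).length) (hDE : ∀ i, (List.ofFn (E i)).flatten = D i)
    (hE : ∀ i k, E i k ≠ []) : Conjugate (shiftSpace σ) (shiftSpace (towerSubst θ E)) := by
  have hτ := isMorph_wordMap (towerSubst θ E)
  have hcov : ∀ x ∈ (shiftSpace σ).carrier, ∀ j, ∃ b, Covers θ a x j b :=
    fun x hx j => hX.exists_covers H ha hx j
  choose φ hφ using fun (x : (shiftSpace σ).carrier) j => hcov x.1 x.2 j
  let π : Tower θ → A := fun b => (θ b.1)[b.2]
  have hπ : ∀ x j b, Covers θ a x j b → π b = x j := by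
    intro x j b h
    have h1 := (factor_eq_append h).1
    simp only [π]
    have h2 : (factor x (j - (b.2 : ℕ)) (θ b.1).length)[(b.2 : ℕ)]'(by simp) =
        (θ b.1)[(b.2 : ℕ)] := by simp only [h1]
    simp only [factor, List.getElem_ofFn] at h2
    rw [Fin.getElem_fin, ← h2]
    congr 1
    omega
  -- A tower letter lies in the code of a whole return word, whose iterated images code words of the
  -- given shift.
  have hlangτ : ∀ w ∈ language (towerSubst θ E), ∃ x j, factor (φ x) j w.length = w := by
    intro w hw
    obtain ⟨n, b, h⟩ := mem_language.1 hw
    have hb : [b] <:+: code θ [b.1] := by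
      obtain ⟨s, t, hst⟩ := List.append_of_mem
        (mem_code (l := [b.1]).2 (List.mem_singleton_self b.1))
      exact ⟨s, t, by simp [hst]⟩
    replace h := h.trans ((hτ.iterate n).infix hb)
    rw [wordMap_towerSubst_iterate_code hDE] at h
    obtain ⟨x, hx, i, hi⟩ := hDX [b.1] (by simpa [spell] using H.append_mem b.1) n
    rw [List.length_append, List.length_singleton] at hi
    rw [← H.factor_eq_code (hφ ⟨x, hx⟩) hi] at h
    obtain ⟨k, -, hk⟩ := exists_factor_of_infix h
    exact ⟨_, _, hk⟩
  -- Conversely, occurrences of `a` on both sides enclose a window of `φ x` in some `code θ l`. By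
  -- minimality `spell θ l ++ [a]` occurs in every long iterate of a return word.
  have hφτ : ∀ x, φ x ∈ (shiftSpace (towerSubst θ E)).carrier := by
    intro x i n
    obtain ⟨N, hN⟩ := hX.exists_infix_of_le_length ha
    have hocc : ∀ i : ℤ, ∃ k : ℕ, k < N ∧ x.1 (i + k) = a := fun i =>
      mem_factor.1 ((hN _ (factor_mem_lang x.2 i N) (by simp)).subset (List.mem_singleton_self a))
    obtain ⟨s, hs, hsa⟩ := hocc (i - N)
    obtain ⟨e, he, hea⟩ := hocc (i + n)
    obtain ⟨m, hm⟩ := Int.le.dest (show i - N + s ≤ i + n + e by omega)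
    have hfac : factor x.1 (i - N + s) (m + 1) = factor x.1 (i - N + s) m ++ [a] := by
      rw [factor_add, factor_one, hm, hea]
    obtain ⟨l, hl⟩ := H.exists_spell_eq (factor x.1 (i - N + s) m)
      (by rw [← hfac, factor_succ, hsa]; rfl) (by rw [← hfac]; exact factor_mem_lang x.2 _ _)
    have hlX : spell θ l ++ [a] ∈ lang (shiftSpace σ) := by
      rw [hl, ← hfac]; exact factor_mem_lang x.2 _ _
    have hlm : (spell θ l).length = m := by rw [hl]; simp
    have hcode := H.factor_eq_code (hφ x) (l := l) (i := i - N + s) (by rw [hlm, hfac, hl])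
    have hin : factor (φ x) i n <:+: code θ l := by
      rw [← hcode]
      exact factor_infix_factor' _ (by omega) (by omega)
    obtain ⟨M, hM⟩ := hX.exists_infix_of_le_length hlX
    -- Any tower letter would do: its image starts with the code of a return word `r`.
    have b := φ x 0
    obtain ⟨r, t, hrt⟩ := List.exists_cons_of_ne_nil (hE b.1 b.2)
    have hgrow : ∀ n, n ≤ ((fun l : List I => l.flatMap D)^[n] [r]).length := by
      have htwo : ∀ l : List I, 2 * l.length ≤ (l.flatMap D).length := by
        intro l
        induction l with
        | nil => simp
        | cons i l ih =>
          have := hD i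
          simp only [List.flatMap_cons, List.length_append, List.length_cons]
          omega
      have : ∀ n, n + 1 ≤ ((fun l : List I => l.flatMap D)^[n] [r]).length := by
        intro n
        induction n with
        | zero => simp
        | succ n ih =>
          rw [Function.iterate_succ_apply']
          have := htwo ((fun l : List I => l.flatMap D)^[n] [r])
          omega
      exact fun n => (Nat.le_succ n).trans (this n)
    have hrX := hDX [r] (by simpa [spell] using H.append_mem r) M
    have hlr := hM _ hrX (by
      have h1 := hgrow M
      have h2 := H.length_le_length_spell ((fun l : List I => l.flatMap D)^[M] [r])
      rw [List.length_append]
      omega)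
    refine mem_language.2 ⟨M + 1, b, ?_⟩
    rw [Function.iterate_succ_apply, wordMap_towerSubst_singleton, hrt]
    refine hin.trans ((H.code_infix_code hcov hlr hrX).trans ?_)
    rw [← wordMap_towerSubst_iterate_code hDE]
    refine (hτ.iterate M).infix ?_
    exact ⟨[], code θ t, (isMorph_code [r] t).symm⟩
  have hback : ∀ y ∈ (shiftSpace (towerSubst θ E)).carrier, ∀ i n, ∃ x j,
      factor (φ x) j n = factor y i n := by
    intro y hy i n
    obtain ⟨x, j, h⟩ := hlangτ _ (hy i n)
    exact ⟨x, j, by simpa using h⟩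
  have hπφ : ∀ x j, π (φ x j) = x.1 j := fun x j => hπ _ _ _ (hφ x j)
  have hπfac : ∀ x j n, (factor (φ x) j n).map π = factor x.1 j n := by
    intro x j n
    rw [← factor_map]
    congr 1
    exact funext (hπφ x)
  have hπX : ∀ y ∈ (shiftSpace (towerSubst θ E)).carrier,
      (fun j => π (y j)) ∈ (shiftSpace σ).carrier := by
    intro y hy i n
    obtain ⟨x, j, h⟩ := hback y hy i n
    rw [factor_map, ← h, hπfac]
    exact x.2 j n
  obtain ⟨K, hK⟩ : ∃ K, ∀ i, (θ i).length ≤ K := by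
    obtain ⟨K, hK⟩ := (Set.finite_range fun i => (θ i).length).bddAbove
    exact ⟨K, fun i => hK ⟨i, rfl⟩⟩
  have hφπ : ∀ y (hy : y ∈ (shiftSpace (towerSubst θ E)).carrier),
      φ ⟨fun j => π (y j), hπX y hy⟩ = y := by
    intro y hy
    funext i
    -- The point `x` depends on the window, but radius `K` bounds all return words, so this window
    -- determines the coding at `i`.
    obtain ⟨x, j, h⟩ := hback y hy (i - K) (K + K + 1)
    refine H.covers_unique (hφ _ i) ?_
    have hx : factor x.1 j (K + K + 1) = factor (fun j => π (y j)) (i - K) (K + K + 1) := by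
      rw [factor_map π y, ← h, hπfac]
    have hyi : φ x (j + K) = y i := by
      have := factor_eq_factor_iff.1 h K (by omega)
      rwa [sub_add_cancel] at this
    rw [← hyi]
    exact (hφ x (j + K)).congr (hK _) (by rwa [add_sub_cancel_right])
  refine ⟨⟨⟨fun x => ⟨φ x, hφτ x⟩, fun y => ⟨fun j => π (y.1 j), hπX y.1 y.2⟩, ?_, ?_⟩, ?_, ?_⟩, ?_⟩
  · intro x
    exact Subtype.ext (funext fun j => hπφ x j)
  · intro y
    exact Subtype.ext (hφπ y.1 y.2)
  · refine Continuous.subtype_mk (continuous_pi fun j => ?_) _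
    rw [continuous_discrete_rng]
    intro b
    have hset : (fun x => φ x j) ⁻¹' {b} =
        Subtype.val ⁻¹' {x : ℤ → A | factor x (j - (b.2 : ℕ)) ((θ b.1).length + 1) ∈
          ({θ b.1 ++ [a]} : Set (List A))} := by
      ext x
      constructor
      · rintro rfl
        exact hφ x j
      · intro h
        exact H.covers_unique (hφ x j) h
    rw [hset]
    exact (isClopen_factor_mem _ _ _).isOpen.preimage continuous_subtype_val
  · refine Continuous.subtype_mk (continuous_pi fun j => ?_) _
    exact (continuous_of_discreteTopology (f := π)).comp
      ((continuous_apply j).comp continuous_subtype_val)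
  · intro x
    funext j
    exact H.covers_unique (hφ _ j) (covers_shift.2 (hφ x (1 + j)))

end Conjugacy

end SubstitutionShift

theorem mainTheorem5 {A : Type*} [Finite A] [TopologicalSpace A] [DiscreteTopology A]
    (σ : FreeMonoid A →* FreeMonoid A)
    (hσ : SubstitutionShift.IsMinimal (SubstitutionShift.shiftSpace σ)) :
    ∃ (B : Type) (_ : Finite B) (_ : TopologicalSpace B) (_ : DiscreteTopology B)
      (τ : FreeMonoid B →* FreeMonoid B),
      SubstitutionShift.IsPrimitive τ ∧
        SubstitutionShift.Conjugate (SubstitutionShift.shiftSpace σ)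
          (SubstitutionShift.shiftSpace τ) := by
  obtain ⟨f, a, hf, hfX, ha, hgr⟩ := hσ.exists_isMorph
  obtain ⟨N, θ, H⟩ := hσ.exists_isReturnSystem ha
  obtain ⟨T, p, s, D, hT, hTX, hps, hD, hlen, hall⟩ := hσ.exists_derived H ha hf hfX hgr
  choose E hE hED using fun i =>
    SubstitutionShift.exists_ofFn_flatten_eq (H.length_pos i) (hlen i).2
  refine ⟨SubstitutionShift.Tower θ, inferInstance, inferInstance, inferInstance,
    SubstitutionShift.towerSubst θ E, SubstitutionShift.isPrimitive_towerSubst hED hE hall, ?_⟩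
  exact SubstitutionShift.conjugate_towerSubst hσ H ha
    (fun l hl n => SubstitutionShift.spell_iterate_mem_lang hT hTX hps hD hl n)
    (fun i => (hlen i).1) hED hE
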